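/- Let $k\in\{1,2\}$, let $A,B\in\mathbb Z$ with $AB\neq 0$, and suppose that $f(x)=x^6+Ax^{2k}+B$ is irreducible over $\mathbb Q$. Put $\delta=4A^3+27B^{3-k}$. Then the discriminant of $f$ is $$\Delta(f)=-64\,B^{2k-1}\delta^2 .$$ Let $K=\mathbb Q(\theta)$ with $f(\theta)=0$, and let $\mathbb Z_K$ be the ring of integers of $K$. For $n\in\mathbb Z$ and $m\ge 2$ let $n \bmod m$ denote the residue of $n$ in $\{0,1,\dots,m-1\}$, and let $$\mathcal R_k=\{(0,2),(0,4),(0,5),(0,7),(3,1),(3,2),(3,8),(3,10-3k),(6,1),(6,5),(6,8),(6,3k+1)\}.$$ A prime factor $p$ of $\Delta(f)$ does not divide the index $[\mathbb Z_K:\mathbb Z[\theta]]$ if and only if one of the following holds: 1. $p\mid A$, $p\mid B$ and $p^2\nmid B$; 2. $p\mid A$, $p\nmid B$, and either $p=2$ with $(A \bmod 4,\ B \bmod 4)\in\{(0,1),(2,3)\}$, or $p=3$ with $(A \bmod 9,\ B \bmod 9)\in\mathcal R_k$; 3. $p\nmid A$, $p\mid B$, and either $p\neq 2$ with $p^2\nmid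 B$, or $p=2$ with $(A \bmod 4,\ B \bmod 4)=(3,2)$; 4. $p=2$ and $2\nmid AB$ (so $2$ never divides the index when $AB$ is odd); 5. $p\nmid 2AB$ and $p^2\nmid\delta$. -/

import Mathlib

open Polynomial

/-- The trinomial `x ^ 6 + A x ^ (2 k) + B`. -/
noncomputable def evenSextic (A B : ℤ) (k : ℕ) : ℤ[X] :=
  X ^ 6 + C A * X ^ (2 * k) + C B

/-- `δ = 4 A ^ 3 + 27 B ^ (3 - k)`, used for `k = 1` and `k = 2` only. -/
def sexticDelta (A B : ℤ) (k : ℕ) : ℤ :=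
  4 * A ^ 3 + 27 * B ^ (3 - k)

/-- The set `R_k` of pairs of residues modulo `9`. -/
def residuePairs (k : ℕ) : Set (ℤ × ℤ) :=
  {(0, 2), (0, 4), (0, 5), (0, 7),
   (3, 1), (3, 2), (3, 8), (3, 10 - 3 * (k : ℤ)),
   (6, 1), (6, 5), (6, 8), (6, 3 * (k : ℤ) + 1)}

/-- The index `[ℤ_K : ℤ[θ]]` of additive groups, where `ℤ_K`, the integral closure of `ℤ` in `K`,
is the ring of integers of `K`; meant for `θ` integral over `ℤ`, so that `ℤ[θ] ⊆ ℤ_K`. -/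
noncomputable def integersIndex {K : Type*} [Field K] (θ : K) : ℕ :=
  (Subalgebra.toSubmodule (Algebra.adjoin ℤ {θ})).toAddSubgroup.relIndex
    (Subalgebra.toSubmodule (integralClosure ℤ K)).toAddSubgroup

/-! The index is controlled by a form of Dedekind's criterion: `p` is prime to `[ℤ_K : ℤ[θ]]` as
soon as `f ∉ M ^ 2` for every maximal ideal `M ∋ p` of `ℤ[X]` (`not_dvd_integersIndex`), and `p`
divides it as soon as `f ∈ (p, g) ^ 2` for a single monic nonconstant `g`, irreducible modulo `p` or
not (`dvd_integersIndex`). Geometrically, `f ∉ M ^ 2` says that `ℤ[X]/(f)` is regular at `M`, so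
that its local ring there is integrally closed.

What remains is local. Modulo `p` the sextic is explicit enough to list its repeated factors `g`; if
`f = g q + r` with `deg r < deg g`, then `f ∈ (p, g) ^ 2` forces `p ^ 2` to divide every coefficient
of `r` (`sq_dvd_coeff_of_mem_sq`). This gives the congruences modulo 4 and 9 and the condition on `p
^ 2 ∣ B`. For `p ∤ 2AB` the repeated factor is a quadratic in `X`, and identities writing a multiple
of `f` as a multiple of its square plus multiples of `δ` replace `r` by `δ`.

The discriminant is the resultant of `f` and `f'`, computed by Euclidean division. -/

/-- If locally at every maximal ideal containing `p` the maximal ideal is principal, witnessed by a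
relation between two generators, then `R` is integrally closed at `p`. -/
theorem mem_range_algebraMap_of_isIntegral {R K : Type*} [CommRing R] [IsDomain R]
    [IsNoetherianRing R] [Field K] [Algebra R K] [IsFractionRing R K] {p : R} {β : K}
    (hβ : IsIntegral R β) (hp : algebraMap R K p * β ∈ (algebraMap R K).range)
    (h : ∀ M : Ideal R, M.IsMaximal → p ∈ M →
      ∃ x y a b, M = Ideal.span {x, y} ∧ x * a + y * b = 0 ∧ (a ∉ M ∨ b ∉ M)) :
    β ∈ (algebraMap R K).range := by
  -- The denominators of `β`. If they do not fill `R`, they lie in some maximal `M`, and integral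
  -- closedness of `R_M` produces a denominator outside `M`.
  let D : Ideal R :=
    { carrier := {r | algebraMap R K r * β ∈ (algebraMap R K).range}
      add_mem' := fun {a b} ha hb => by
        simp only [Set.mem_ofPred_eq, map_add, add_mul] at *
        exact add_mem ha hb
      zero_mem' := by simp
      smul_mem' := fun c x hx => by
        simp only [Set.mem_ofPred_eq, smul_eq_mul, map_mul, mul_assoc] at *
        exact mul_mem ⟨c, rfl⟩ hx }
  by_cases hD : D = ⊤
  · have : (1 : R) ∈ D := hD ▸ Submodule.mem_top
    simpa [D] using this
  obtain ⟨M, hM, hDM⟩ := Ideal.exists_le_maximal D hD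
  obtain ⟨x, y, a, b, hxy, hrel, hab⟩ := h M hM (hDM hp)
  let S := Localization.AtPrime M
  let T := FractionRing R
  have key : ∀ x y a b : R, M = Ideal.span {x, y} → x * a + y * b = 0 → a ∉ M →
      (IsLocalRing.maximalIdeal S).IsPrincipal := by
    intro x y a b hxy hrel ha
    -- Since `a` is a unit in `R_M`, the relation expresses `x` as a multiple of `y`.
    have hu : IsUnit (algebraMap R S a) :=
      IsLocalization.map_units S (⟨a, ha⟩ : M.primeCompl)
    obtain ⟨u, hu⟩ := hu
    rw [← Localization.AtPrime.map_eq_maximalIdeal]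
    have : Ideal.map (algebraMap R S) M = Ideal.span {algebraMap R S y} := by
      conv_lhs => rw [congrArg (Ideal.map (algebraMap R S)) hxy, Ideal.map_span, Set.image_pair]
      refine le_antisymm (Ideal.span_le.2 ?_) (Ideal.span_mono (by simp))
      rintro _ (rfl | rfl)
      · have h1 := congrArg (algebraMap R S) hrel
        simp only [map_add, map_mul, map_zero, ← hu] at h1
        refine Ideal.mem_span_singleton'.2 ⟨-(algebraMap R S b) * ↑u⁻¹, ?_⟩
        linear_combination (-(↑u⁻¹ : S)) * h1 + algebraMap R S x * u.inv_mul
      · exact Ideal.subset_span rfl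
    exact this ▸ ⟨⟨_, rfl⟩⟩
  have hprin : (IsLocalRing.maximalIdeal S).IsPrincipal := by
    rcases hab with ha | hb
    · exact key x y a b hxy hrel ha
    · exact key y x b a (by rw [hxy, Set.pair_comm]) (by rw [add_comm, hrel]) hb
  have : IsNoetherianRing S := IsLocalization.isNoetherianRing M.primeCompl S inferInstance
  have : IsDomain S := IsLocalization.isDomain_localization M.primeCompl_le_nonZeroDivisors
  -- A Noetherian local domain with principal maximal ideal is a PID, hence integrally closed.
  have : IsPrincipalIdealRing S :=
    ((tfae_of_isNoetherianRing_of_isLocalRing_of_isDomain S).out 4 0).1 hprin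
  have : IsFractionRing S T :=
    IsFractionRing.isFractionRing_of_isDomain_of_isLocalization M.primeCompl S T
  let e : K ≃ₐ[R] T := IsLocalization.algEquiv (nonZeroDivisors R) K T
  have h1 : IsIntegral S (e β) := (hβ.map e).tower_top
  obtain ⟨s, hs⟩ := IsIntegrallyClosed.isIntegral_iff.1 h1
  obtain ⟨⟨r, t⟩, hrt⟩ := IsLocalization.surj M.primeCompl s
  exfalso
  refine t.2 (hDM (show algebraMap R K t * β ∈ (algebraMap R K).range from ⟨r, e.injective ?_⟩))
  have h2 := congrArg (algebraMap S T) hrt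
  rw [map_mul, hs, ← IsScalarTower.algebraMap_apply, ← IsScalarTower.algebraMap_apply] at h2
  rw [map_mul, e.commutes, e.commutes, ← h2, mul_comm]

/-! ### Ideals of `ℤ[X]` containing a prime `p` -/

section spanPair

variable {p : ℕ}

theorem Ideal.mem_span_pair_sq {R : Type*} [CommRing R] {x y z : R} :
    z ∈ Ideal.span {x, y} ^ 2 ↔ ∃ a b c, z = y ^ 2 * a + x * y * b + x ^ 2 * c := by
  rw [sq, Ideal.span_pair_mul_span_pair]
  simp only [Ideal.mem_span_insert, Ideal.mem_span_singleton']
  constructor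
  · rintro ⟨a, _, ⟨b, _, ⟨c, _, ⟨d, rfl⟩, rfl⟩, rfl⟩, rfl⟩
    exact ⟨d, b + c, a, by ring⟩
  · rintro ⟨a, b, c, rfl⟩
    exact ⟨c, _, ⟨b, _, ⟨0, _, ⟨a, rfl⟩, rfl⟩, rfl⟩, by ring⟩

theorem comap_mapRingHom_eq (I : Ideal ℤ[X]) :
    (I.map (mapRingHom (Int.castRingHom (ZMod p)))).comap (mapRingHom (Int.castRingHom (ZMod p)))
      = I ⊔ Ideal.span {C (p : ℤ)} := by
  have hs : Function.Surjective (mapRingHom (Int.castRingHom (ZMod p))) :=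
    map_surjective _ ZMod.intCast_surjective
  rw [Ideal.comap_map_of_surjective _ hs]
  congr 1
  change RingHom.ker _ = _
  rw [ker_mapRingHom, ZMod.ker_intCastRingHom, Ideal.map_span, Set.image_singleton]

theorem isMaximal_span_pair [Fact p.Prime] {g : ℤ[X]}
    (hg : Irreducible (g.map (Int.castRingHom (ZMod p)))) :
    (Ideal.span {C (p : ℤ), g}).IsMaximal := by
  have hs : Function.Surjective (mapRingHom (Int.castRingHom (ZMod p))) :=
    map_surjective _ ZMod.intCast_surjective
  have h := comap_mapRingHom_eq (p := p) (Ideal.span {g})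
  rw [Ideal.map_span, Set.image_singleton, sup_comm, ← Ideal.span_insert] at h
  rw [← h]
  have := PrincipalIdealRing.isMaximal_of_irreducible hg
  exact Ideal.comap_isMaximal_of_surjective _ hs (H := this)

/-- Ideals containing `p` are pulled back from the principal ideal ring `𝔽_p[X]`. -/
theorem exists_eq_span_pair [Fact p.Prime] {M : Ideal ℤ[X]} (hM : C (p : ℤ) ∈ M) :
    ∃ g, M = Ideal.span {C (p : ℤ), g} := by
  have hs : Function.Surjective (mapRingHom (Int.castRingHom (ZMod p))) :=
    map_surjective _ ZMod.intCast_surjective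
  obtain ⟨g', hg'⟩ := IsPrincipalIdealRing.principal
    (M.map (mapRingHom (Int.castRingHom (ZMod p))))
  obtain ⟨g, rfl⟩ := hs g'
  refine ⟨g, ?_⟩
  have h1 := comap_mapRingHom_eq (p := p) M
  have h2 := comap_mapRingHom_eq (p := p) (Ideal.span {g})
  rw [Ideal.map_span, Set.image_singleton, sup_comm, ← Ideal.span_insert] at h2
  rw [hg', sup_eq_left.2 ((Ideal.span_singleton_le_iff_mem _).2 hM)] at h1
  exact h1.symm.trans h2

end spanPair

/-! ### The index criterion -/

section index

variable {K : Type*} [Field K] {θ : K} {f : ℤ[X]} {p : ℕ}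

theorem mem_adjoin_int_iff {x : K} : x ∈ Algebra.adjoin ℤ {θ} ↔ ∃ q : ℤ[X], aeval θ q = x := by
  rw [Algebra.adjoin_singleton_eq_range_aeval]
  rfl

/-- The class of `β` has order `p` in the quotient. Finiteness is not needed: an infinite quotient
has `Nat.card` equal to 0. -/
theorem dvd_integersIndex_of_exists {β : K} (hp : p.Prime) (hβ : IsIntegral ℤ β)
    (hpβ : (p : K) * β ∈ Algebra.adjoin ℤ {θ}) (hn : β ∉ Algebra.adjoin ℤ {θ}) :
    p ∣ integersIndex θ := by
  unfold integersIndex AddSubgroup.relIndex AddSubgroup.index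
  set H := (Subalgebra.toSubmodule (Algebra.adjoin ℤ {θ})).toAddSubgroup
  set G := (Subalgebra.toSubmodule (integralClosure ℤ K)).toAddSubgroup
  let x : G := ⟨β, hβ⟩
  have hord : addOrderOf (x : G ⧸ H.addSubgroupOf G) = p := by
    have := Fact.mk hp
    refine addOrderOf_eq_prime ?_ ?_
    · rw [← QuotientAddGroup.mk_nsmul, QuotientAddGroup.eq_zero_iff, AddSubgroup.mem_addSubgroupOf]
      change p • β ∈ Algebra.adjoin ℤ {θ}
      rwa [nsmul_eq_mul]
    · rw [Ne, QuotientAddGroup.eq_zero_iff, AddSubgroup.mem_addSubgroupOf]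
      exact hn
  exact hord ▸ addOrderOf_dvd_natCard _

theorem exists_natCast_mul_mem_adjoin [NumberField K]
    (hθ : IntermediateField.adjoin ℚ {θ} = ⊤) (x : K) :
    ∃ n : ℤ, n ≠ 0 ∧ (n : K) * x ∈ Algebra.adjoin ℤ {θ} := by
  have hx : x ∈ (IntermediateField.adjoin ℚ {θ}).toSubalgebra := by
    rw [hθ]; trivial
  rw [IntermediateField.adjoin_simple_toSubalgebra_of_isAlgebraic
    (Algebra.IsAlgebraic.isAlgebraic θ), Algebra.adjoin_singleton_eq_range_aeval] at hx
  obtain ⟨q, rfl⟩ := hx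
  obtain ⟨b, hb, hq⟩ := IsLocalization.integerNormalization_spec (nonZeroDivisors ℤ) q
  refine ⟨b, nonZeroDivisors.ne_zero hb, mem_adjoin_int_iff.2
    ⟨IsLocalization.integerNormalization (nonZeroDivisors ℤ) q, ?_⟩⟩
  rw [← aeval_map_algebraMap ℚ, hq, map_zsmul, zsmul_eq_mul]
  rfl

theorem isFractionRing_adjoin [NumberField K] (hθ : IntermediateField.adjoin ℚ {θ} = ⊤) :
    IsFractionRing (Algebra.adjoin ℤ {θ}) K := by
  refine IsFractionRing.of_field _ _ fun z => ?_
  obtain ⟨n, hn, h⟩ := exists_natCast_mul_mem_adjoin hθ z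
  refine ⟨⟨_, h⟩, (n : Algebra.adjoin ℤ {θ}), ?_⟩
  have : (n : K) ≠ 0 := by exact_mod_cast hn
  rw [map_intCast]
  change z = (n : K) * z / n
  field_simp

theorem finite_quotient_adjoin [NumberField K] (hθ : IntermediateField.adjoin ℚ {θ} = ⊤) :
    Finite ((Subalgebra.toSubmodule (integralClosure ℤ K)).toAddSubgroup ⧸
      (Subalgebra.toSubmodule (Algebra.adjoin ℤ {θ})).toAddSubgroup.addSubgroupOf
        (Subalgebra.toSubmodule (integralClosure ℤ K)).toAddSubgroup) := by
  have : Module.Finite ℤ (integralClosure ℤ K) :=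
    Module.IsNoetherian.finite ℤ (NumberField.RingOfIntegers K)
  let N : Submodule ℤ (integralClosure ℤ K) :=
    (Subalgebra.toSubmodule (Algebra.adjoin ℤ {θ})).comap
      (Subalgebra.toSubmodule (integralClosure ℤ K)).subtype
  have hfin : Finite (integralClosure ℤ K ⧸ N) := by
    refine Module.finite_of_fg_torsion _ ?_
    rintro ⟨x⟩
    obtain ⟨n, hn, h⟩ := exists_natCast_mul_mem_adjoin hθ (x : K)
    refine ⟨⟨n, mem_nonZeroDivisors_of_ne_zero hn⟩, ?_⟩
    refine (Submodule.Quotient.mk_eq_zero N).2 ?_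
    change n • (x : K) ∈ Algebra.adjoin ℤ {θ}
    rwa [zsmul_eq_mul]
  exact hfin

theorem exists_of_dvd_integersIndex [NumberField K] (hθ : IntermediateField.adjoin ℚ {θ} = ⊤)
    (hp : p.Prime) (h : p ∣ integersIndex θ) :
    ∃ β : K, IsIntegral ℤ β ∧ (p : K) * β ∈ Algebra.adjoin ℤ {θ} ∧
      β ∉ Algebra.adjoin ℤ {θ} := by
  have := Fact.mk hp
  have := finite_quotient_adjoin hθ
  obtain ⟨x, hx⟩ := exists_prime_addOrderOf_dvd_card' p h
  obtain ⟨⟨β, hβ⟩, rfl⟩ := QuotientAddGroup.mk_surjective x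
  refine ⟨β, hβ, ?_, fun hmem => ?_⟩
  · have h0 := addOrderOf_nsmul_eq_zero (QuotientAddGroup.mk (⟨β, hβ⟩ :
      (Subalgebra.toSubmodule (integralClosure ℤ K)).toAddSubgroup) :
      _ ⧸ (Subalgebra.toSubmodule (Algebra.adjoin ℤ {θ})).toAddSubgroup.addSubgroupOf _)
    rw [hx, ← QuotientAddGroup.mk_nsmul, QuotientAddGroup.eq_zero_iff,
      AddSubgroup.mem_addSubgroupOf] at h0
    rw [← nsmul_eq_mul]
    exact h0
  · rw [(QuotientAddGroup.eq_zero_iff _).2 (AddSubgroup.mem_addSubgroupOf.2 hmem),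
      addOrderOf_zero] at hx
    exact hp.one_lt.ne hx

/-- A polynomial of `ℤ[X]` vanishing at a root of the irreducible monic `f` is divisible by `f`. -/
theorem dvd_of_aeval_eq_zero [CharZero K] (hf : f.Monic)
    (hirr : Irreducible (f.map (Int.castRingHom ℚ))) (h0 : aeval θ f = 0) {q : ℤ[X]}
    (hq : aeval θ q = 0) : f ∣ q := by
  have := hf.map (Int.castRingHom ℚ)
  have hmin : f.map (Int.castRingHom ℚ) = minpoly ℚ θ := by
    refine minpoly.eq_of_irreducible_of_monic hirr ?_ this
    exact (aeval_map_algebraMap ℚ θ f).trans h0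
  rw [← map_dvd_map (Int.castRingHom ℚ) Int.cast_injective hf, hmin]
  exact minpoly.dvd ℚ θ ((aeval_map_algebraMap ℚ θ q).trans hq)

/-- Write `f = g²a + pgb + p²c`. The new integer is `β = g(θ)a(θ)/p`: multiplying `f(θ) = 0` by
`a(θ)/p²` gives `β² + b(θ)β + c(θ)a(θ) = 0`. Were `β` in `ℤ[θ]`, then `f ≡ g²a` would divide `ga`
modulo `p`, making `g` a unit there. -/
theorem dvd_integersIndex [CharZero K] (hf : f.Monic)
    (hirr : Irreducible (f.map (Int.castRingHom ℚ))) (h0 : aeval θ f = 0) (hp : p.Prime)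
    {g : ℤ[X]} (hg : g.Monic) (hdeg : 0 < g.natDegree)
    (hmem : f ∈ Ideal.span {C (p : ℤ), g} ^ 2) : p ∣ integersIndex θ := by
  have := Fact.mk hp
  obtain ⟨a, b, c, habc⟩ := Ideal.mem_span_pair_sq.1 hmem
  have hpK : (p : K) ≠ 0 := by exact_mod_cast hp.ne_zero
  have hrel := congrArg (aeval θ) habc
  simp only [h0, map_add, map_mul, map_pow, aeval_C, algebraMap_int_eq, Int.coe_castRingHom,
    Int.cast_natCast] at hrel
  have hint : ∀ q : ℤ[X], aeval θ q ∈ integralClosure ℤ K := fun q =>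
    adjoin_le_integralClosure ⟨f, hf, h0⟩ (aeval_mem_adjoin_singleton ℤ θ)
  have hβp : (p : K) * (aeval θ g * aeval θ a / p) = aeval θ (g * a) := by
    rw [map_mul]
    field_simp
  refine dvd_integersIndex_of_exists (β := aeval θ g * aeval θ a / p) hp ?_ ?_ ?_
  · refine isIntegral_trans (A := integralClosure ℤ K) _
      ⟨X ^ 2 + C ⟨_, hint b⟩ * X + C ⟨_, hint (c * a)⟩, by monicity!, ?_⟩
    simp only [eval₂_add, eval₂_mul, eval₂_pow, eval₂_X, eval₂_C, map_mul]
    change _ + aeval θ b * _ + aeval θ c * aeval θ a = 0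
    field_simp
    linear_combination (-aeval θ a) * hrel
  · rw [hβp]
    exact aeval_mem_adjoin_singleton ℤ θ
  · intro hmem'
    obtain ⟨q, hq⟩ := mem_adjoin_int_iff.1 hmem'
    rw [← hq] at hβp
    have hz : aeval θ (g * a - C (p : ℤ) * q) = 0 := by
      rw [map_sub, ← hβp]
      simp
    have hdvd := Polynomial.map_dvd (Int.castRingHom (ZMod p)) (dvd_of_aeval_eq_zero hf hirr h0 hz)
    have hfp := congrArg (Polynomial.map (Int.castRingHom (ZMod p))) habc
    simp only [Polynomial.map_add, Polynomial.map_mul, Polynomial.map_pow, Polynomial.map_sub,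
      eq_intCast, Int.cast_natCast, Polynomial.map_natCast, CharP.cast_eq_zero, zero_mul,
      add_zero, sub_zero, ne_eq, OfNat.ofNat_ne_zero, not_false_eq_true, zero_pow] at hdvd hfp
    have hne := (hf.map (Int.castRingHom (ZMod p))).ne_zero
    rw [hfp] at hdvd hne
    set g' := g.map (Int.castRingHom (ZMod p))
    set a' := a.map (Int.castRingHom (ZMod p))
    have hga : g' * a' ≠ 0 := fun h => hne (by rw [sq, mul_assoc, h, mul_zero])
    have hu : g' ∣ 1 := by
      refine (mul_dvd_mul_iff_right hga).1 ?_
      rwa [one_mul, ← mul_assoc, ← sq]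
    have := natDegree_eq_zero_of_isUnit (isUnit_of_dvd_one hu)
    rw [hg.natDegree_map] at this
    omega

/-- A maximal ideal of `ℤ[θ]` above `p` pulls back to `M = (p, g)`. Writing `f = ap + bg` gives a
relation between the two generators in `ℤ[θ]`; if both coefficients lay in `M`, then `f` would lie
in `M ^ 2`. -/
theorem not_dvd_integersIndex [NumberField K] (h0 : aeval θ f = 0)
    (hθ : IntermediateField.adjoin ℚ {θ} = ⊤) (hp : p.Prime)
    (h : ∀ M : Ideal ℤ[X], M.IsMaximal → C (p : ℤ) ∈ M → f ∉ M ^ 2) :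
    ¬ p ∣ integersIndex θ := by
  have := Fact.mk hp
  intro hdvd
  obtain ⟨β, hβ, hpβ, hn⟩ := exists_of_dvd_integersIndex hθ hp hdvd
  have := isFractionRing_adjoin hθ
  let φ : ℤ[X] →ₐ[ℤ] Algebra.adjoin ℤ {θ} :=
    aeval ⟨θ, Algebra.self_mem_adjoin_singleton ℤ θ⟩
  have hφ : ∀ q, (φ q : K) = aeval θ q := fun q =>
    (aeval_algebraMap_apply K (⟨θ, Algebra.self_mem_adjoin_singleton ℤ θ⟩ :
      Algebra.adjoin ℤ {θ}) q).symm
  have hs : Function.Surjective φ := fun x => by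
    obtain ⟨q, hq⟩ := mem_adjoin_int_iff.1 x.2
    exact ⟨q, Subtype.ext ((hφ q).trans hq)⟩
  have : IsNoetherianRing (Algebra.adjoin ℤ {θ}) :=
    isNoetherianRing_of_surjective _ _ (φ : ℤ[X] →+* _) hs
  have hφf : φ f = 0 := Subtype.ext ((hφ f).trans h0)
  have hmem := mem_range_algebraMap_of_isIntegral (R := Algebra.adjoin ℤ {θ}) (K := K)
    (p := (p : Algebra.adjoin ℤ {θ})) (β := β) hβ.tower_top ⟨⟨_, hpβ⟩, by simp⟩ ?_
  · obtain ⟨y, rfl⟩ := hmem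
    exact hn y.2
  intro N hN hpN
  have hM : (N.comap φ).IsMaximal := Ideal.comap_isMaximal_of_surjective φ hs
  have hpM : C (p : ℤ) ∈ N.comap φ := by
    rw [Ideal.mem_comap]
    simpa [φ] using hpN
  obtain ⟨g, hg⟩ := exists_eq_span_pair hpM
  have hfM : f ∈ N.comap φ := by simp [Ideal.mem_comap, hφf]
  have hgM : g ∈ N.comap φ := hg ▸ Ideal.subset_span (by simp)
  obtain ⟨a, b, hab⟩ := Ideal.mem_span_pair.1 (hg ▸ hfM)
  refine ⟨φ (C (p : ℤ)), φ g, φ a, φ b, ?_, ?_, ?_⟩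
  · rw [← Ideal.map_comap_of_surjective φ hs N, hg, Ideal.map_span, Set.image_pair]
  · rw [← map_mul, ← map_mul, ← map_add, mul_comm, mul_comm g, hab, hφf]
  · by_contra! hcon
    refine h _ hM hpM ?_
    rw [← hab, sq]
    exact add_mem (Ideal.mul_mem_mul hcon.1 hpM) (Ideal.mul_mem_mul hcon.2 hgM)

end index

/-! ### The discriminant -/

theorem evenSextic_eq {k : ℕ} (hk : k = 1 ∨ k = 2) (A B : ℤ) :
    evenSextic A B k = X ^ 2 * (X ^ 4 + C A * X ^ (2 * k - 2)) + C B := by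
  rcases hk with rfl | rfl <;> simp only [evenSextic] <;> ring

theorem natDegree_evenSextic {k : ℕ} (hk : k = 1 ∨ k = 2) (A B : ℤ) :
    (evenSextic A B k).natDegree = 6 := by
  rcases hk with rfl | rfl <;> simp only [evenSextic] <;> compute_degree!

theorem monic_evenSextic {k : ℕ} (hk : k = 1 ∨ k = 2) (A B : ℤ) :
    (evenSextic A B k).Monic := by
  rcases hk with rfl | rfl <;> simp only [evenSextic] <;> monicity!

/-- Resultants are multiplicative. The factor `-64` is `2 ^ 6`, from the constant in `f'`, times the
sign `(-1) ^ (6 * 5 / 2)`; the factor `X ^ m` contributes `f(0) ^ m`. -/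
theorem discr_eq_of_derivative_eq {f h : ℤ[X]} {m n : ℕ} {r B : ℤ} (hf : f.Monic)
    (hdeg : f.natDegree = 6) (hder : derivative f = C 2 * (X ^ m * h)) (hh : h.natDegree = n)
    (hmn : m + n = 5) (hB : f.coeff 0 = B) (hr : f.resultant h 6 n = r) :
    f.discr = -64 * B ^ m * r := by
  have h1 := resultant_deriv (f := f) (natDegree_pos_iff_degree_pos.1 (by omega))
  have h2 : resultant f (X ^ m * h) 6 5 = resultant f (X ^ m) 6 m * resultant f h 6 n := by
    have := resultant_mul_right f (X ^ m) h 6 hdeg.le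
    rwa [natDegree_X_pow, hh, hmn] at this
  rw [hf.leadingCoeff, hder, hdeg, show 6 - 1 = 5 from rfl, resultant_C_mul_right, h2,
    resultant_X_pow_right _ _ _ hdeg.le, hr, hB] at h1
  have h3 : (-1 : ℤ) ^ (6 * m) = 1 := by rw [pow_mul]; norm_num
  rw [h3] at h1
  norm_num at h1
  linarith

theorem discr_evenSextic_one {A : ℤ} (B : ℤ) (hA : A ≠ 0) :
    (evenSextic A B 1).discr = -64 * B * sexticDelta A B 1 ^ 2 := by
  have hk : (1 : ℕ) = 1 ∨ (1 : ℕ) = 2 := by decide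
  set h : ℤ[X] := C 3 * X ^ 4 + C A with hh
  -- The Euclidean remainder `3f - X²h`.
  set s : ℤ[X] := C (2 * A) * X ^ 2 + C (3 * B) with hs
  have hdeg : h.natDegree = 4 := by rw [hh]; compute_degree!
  have hsdeg : s.natDegree = 2 := by rw [hs]; compute_degree!
  have e1 : (2 * A) ^ 4 * resultant s h 2 4 = (2 * A) ^ 4 * sexticDelta A B 1 ^ 2 := by
    -- Pseudo-division of `h` by `s`: the factor is the square of the leading coefficient `2A`,
    -- cancelled later because `A ≠ 0`.
    have : C (4 * A ^ 2) * h = C (sexticDelta A B 1) + s * (C (6 * A) * X ^ 2 - C (9 * B)) := by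
      simp only [hh, hs, sexticDelta, map_mul, map_add, map_pow, map_ofNat]
      ring
    have h1 := resultant_C_mul_right s h 2 4 (4 * A ^ 2)
    rw [this, resultant_add_mul_right _ _ _ _ _ _ hsdeg.le, resultant_C_right] at h1
    · have : s.coeff 2 = 2 * A := by
        simp only [hs, coeff_add, coeff_C_mul, coeff_X_pow, coeff_C]; norm_num
      rw [this] at h1
      linear_combination -h1
    · have : (C (6 * A) * X ^ 2 - C (9 * B)).natDegree ≤ 2 := by compute_degree
      omega
  have e1' := mul_left_cancel₀ (by positivity) e1
  have e2 : 3 ^ 4 * resultant (evenSextic A B 1) h 6 4 = 3 ^ 4 * sexticDelta A B 1 ^ 2 := by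
    have : C 3 * evenSextic A B 1 = s + h * X ^ 2 := by
      simp only [hh, hs, evenSextic, map_mul, map_ofNat]
      ring
    have h1 := resultant_C_mul_left (evenSextic A B 1) h 6 4 3
    rw [this, resultant_add_mul_left _ _ _ _ _ (by simp) hdeg.le,
      -- Here `s` is counted with formal degree 6; the excess 4 costs a factor `3 ^ 4`, a power of
      -- the leading coefficient of `h`.
      show 6 = 2 + 4 from rfl, resultant_add_left_deg _ _ _ _ _ hsdeg.le, e1'] at h1
    have : h.coeff 4 = 3 := by
        simp only [hh, coeff_add, coeff_C_mul, coeff_X_pow, coeff_C]; norm_num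
    rw [this] at h1
    linear_combination -h1
  have e2' := mul_left_cancel₀ (by norm_num) e2
  have := discr_eq_of_derivative_eq (m := 1) (monic_evenSextic hk A B) (natDegree_evenSextic hk A B)
    (h := h) (by
      simp only [evenSextic, hh, derivative_add, derivative_mul, derivative_X_pow, derivative_C]
      simp
      ring) hdeg rfl (B := B)
    (by simp [evenSextic]) e2'
  simpa using this

theorem discr_evenSextic_two (A B : ℤ) :
    (evenSextic A B 2).discr = -64 * B ^ 3 * sexticDelta A B 2 ^ 2 := by
  have hk : (2 : ℕ) = 1 ∨ (2 : ℕ) = 2 := by decide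
  set h : ℤ[X] := C 3 * X ^ 2 + C (2 * A) with hh
  have hdeg : h.natDegree = 2 := by rw [hh]; compute_degree!
  have e : 27 ^ 2 * resultant (evenSextic A B 2) h 6 2 = 27 ^ 2 * sexticDelta A B 2 ^ 2 := by
    have : C 27 * evenSextic A B 2 =
        C (sexticDelta A B 2) + h * (h * (C 3 * X ^ 2 - C A)) := by
      simp only [hh, evenSextic, sexticDelta, map_mul, map_add, map_pow, map_ofNat]
      ring
    have h1 := resultant_C_mul_left (evenSextic A B 2) h 6 2 27
    rw [this, resultant_add_mul_left _ _ _ _ _ _ hdeg.le, resultant_C_left] at h1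
    · have : h.coeff 2 = 3 := by
        simp only [hh, coeff_add, coeff_C_mul, coeff_X_pow, coeff_C]; norm_num
      rw [this] at h1
      linear_combination -h1
    · have : (h * (C 3 * X ^ 2 - C A)).natDegree ≤ 4 := by rw [hh]; compute_degree
      omega
  have e' := mul_left_cancel₀ (by norm_num) e
  exact discr_eq_of_derivative_eq (m := 3) (monic_evenSextic hk A B) (natDegree_evenSextic hk A B)
    (h := h) (by
      simp only [evenSextic, hh, derivative_add, derivative_mul, derivative_X_pow, derivative_C]
      simp
      ring) hdeg rfl (by simp [evenSextic]) e'

/-! ### Tests for membership in `M ^ 2` -/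

section maximalIdeal

variable {p : ℕ} {M : Ideal ℤ[X]}

theorem C_mem_iff_dvd (hp : p.Prime) (hM : M ≠ ⊤) (hpM : C (p : ℤ) ∈ M) {n : ℤ} :
    C n ∈ M ↔ (p : ℤ) ∣ n := by
  refine ⟨fun h => ?_, fun ⟨u, hu⟩ => ?_⟩
  · by_contra hn
    obtain ⟨a, b, hab⟩ := ((Nat.prime_iff_prime_int.1 hp).coprime_iff_not_dvd.2 hn)
    refine hM ((Ideal.eq_top_iff_one _).2 ?_)
    rw [← C_1, ← hab, map_add, map_mul, map_mul]
    exact add_mem (M.mul_mem_left _ hpM) (M.mul_mem_left _ h)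
  · rw [hu, map_mul]
    exact M.mul_mem_right _ hpM

theorem eq_span_pair_of_mem [Fact p.Prime] (hM : M ≠ ⊤) (hpM : C (p : ℤ) ∈ M) {g : ℤ[X]}
    (hg : Irreducible (g.map (Int.castRingHom (ZMod p)))) (hgM : g ∈ M) :
    M = Ideal.span {C (p : ℤ), g} :=
  ((isMaximal_span_pair hg).eq_of_le hM (Ideal.span_le.2 (by
    rintro _ (rfl | rfl) <;> assumption))).symm

/-- Modulo `g`, an element `g²a + pgb + p²c` reduces to `p²` times the remainder of `c`. -/
theorem sq_dvd_coeff_of_mem_sq {g q r : ℤ[X]} (hg : g.Monic) (hr : r.degree < g.degree)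
    (h : g * q + r ∈ Ideal.span {C (p : ℤ), g} ^ 2) (i : ℕ) : (p : ℤ) ^ 2 ∣ r.coeff i := by
  obtain ⟨a, b, c, habc⟩ := Ideal.mem_span_pair_sq.1 h
  have h1 : (g * q + r) %ₘ g = r := (div_modByMonic_unique q r hg ⟨by ring, hr⟩).2
  have h2 : (g * q + r) %ₘ g = C ((p : ℤ) ^ 2) * (c %ₘ g) := by
    refine (div_modByMonic_unique (g * a + C (p : ℤ) * b + C ((p : ℤ) ^ 2) * (c /ₘ g)) _ hg
      ⟨?_, ?_⟩).2
    · have := modByMonic_add_div c g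
      rw [habc, map_pow]
      linear_combination C (p : ℤ) ^ 2 * this
    · rw [← smul_eq_C_mul]
      exact (degree_smul_le _ _).trans_lt (degree_modByMonic_lt c hg)
  rw [← h1, h2, coeff_C_mul]
  exact dvd_mul_right _ _

theorem derivative_mem_of_mem_sq {f : ℤ[X]} (h : f ∈ M ^ 2) : derivative f ∈ M := by
  rw [sq] at h
  refine Submodule.mul_induction_on h (fun a ha b hb => ?_) (fun a b ha hb => ?_)
  · rw [derivative_mul]
    exact add_mem (M.mul_mem_left _ hb) (M.mul_mem_right _ ha)
  · rw [derivative_add]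
    exact add_mem ha hb

/-- If `p = g²a + pgb + p²c`, then `p ∣ ga` since `𝔽_p[X]` is a domain; cancelling `p` puts 1 in
`M`. -/
theorem C_natCast_notMem_sq [Fact p.Prime] (hM : M ≠ ⊤) (hpM : C (p : ℤ) ∈ M) :
    C (p : ℤ) ∉ M ^ 2 := by
  intro h
  have hp : C (p : ℤ) ≠ 0 := by
    simpa using (Fact.out : p.Prime).ne_zero
  have hz : ∀ q : ℤ[X], q.map (Int.castRingHom (ZMod p)) = 0 → ∃ q', q = C (p : ℤ) * q' := by
    intro q hq
    have : q ∈ RingHom.ker (mapRingHom (Int.castRingHom (ZMod p))) := hq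
    rw [ker_mapRingHom, ZMod.ker_intCastRingHom, Ideal.map_span, Set.image_singleton] at this
    exact Ideal.mem_span_singleton.1 this
  obtain ⟨g, hg⟩ := exists_eq_span_pair hpM
  have hgM : g ∈ M := hg ▸ Ideal.subset_span (by simp)
  obtain ⟨a, b, c, habc⟩ := Ideal.mem_span_pair_sq.1 (hg ▸ h)
  have h1 : ∃ d, g * a = C (p : ℤ) * d := by
    have h2 := congrArg (Polynomial.map (Int.castRingHom (ZMod p))) habc
    simp only [Polynomial.map_add, Polynomial.map_mul, Polynomial.map_pow,
      eq_intCast, Int.cast_natCast, Polynomial.map_natCast, CharP.cast_eq_zero, zero_mul,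
      add_zero, ne_eq, OfNat.ofNat_ne_zero, not_false_eq_true, zero_pow] at h2
    refine hz _ ?_
    rw [Polynomial.map_mul]
    rcases mul_eq_zero.1 h2.symm with h3 | h3
    · rw [pow_eq_zero_iff two_ne_zero |>.1 h3, zero_mul]
    · rw [h3, mul_zero]
  obtain ⟨d, hd⟩ := h1
  have h4 : (1 : ℤ[X]) = g * d + g * b + C (p : ℤ) * c :=
    mul_left_cancel₀ hp (by linear_combination habc + g * hd)
  refine hM ((Ideal.eq_top_iff_one _).2 (h4 ▸ ?_))
  exact add_mem (add_mem (M.mul_mem_right _ hgM) (M.mul_mem_right _ hgM)) (M.mul_mem_right _ hpM)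

theorem sq_dvd_of_C_mem_sq [Fact p.Prime] (hM : M ≠ ⊤) (hpM : C (p : ℤ) ∈ M) {n : ℤ}
    (h : C n ∈ M ^ 2) : (p : ℤ) ^ 2 ∣ n := by
  have hp : p.Prime := Fact.out
  obtain ⟨u, rfl⟩ := (C_mem_iff_dvd hp hM hpM).1 (Ideal.pow_le_self two_ne_zero h)
  rw [sq]
  refine mul_dvd_mul_left _ ?_
  by_contra hu
  obtain ⟨a, b, hab⟩ := ((Nat.prime_iff_prime_int.1 hp).coprime_iff_not_dvd.2 hu)
  refine C_natCast_notMem_sq hM hpM ?_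
  have : C (p : ℤ) = C a * C (p : ℤ) ^ 2 + C b * C (p * u : ℤ) := by
    simp only [← map_mul, ← map_pow, ← map_add]
    congr 1
    linear_combination (-(p : ℤ)) * hab
  rw [this]
  exact add_mem (Ideal.mul_mem_left _ _ (Ideal.pow_mem_pow hpM 2)) (Ideal.mul_mem_left _ _ h)

/-- Used for congruences modulo an element of `M`, with `c` as the explicit quotient. -/
theorem mem_of_eq_add {p : ℤ[X]} {u v c : ℤ[X]} (hp : p ∈ M) (hv : v ∈ M) (h : u = v + p * c) :
    u ∈ M :=
  h ▸ add_mem hv (M.mul_mem_right _ hp)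

theorem irreducible_map_of_eval_ne_zero [Fact p.Prime] {g : ℤ[X]} (hg : g.Monic)
    (h2 : 2 ≤ g.natDegree) (h3 : g.natDegree ≤ 3)
    (h : ∀ a : ZMod p, eval₂ (Int.castRingHom (ZMod p)) a g ≠ 0) :
    Irreducible (g.map (Int.castRingHom (ZMod p))) := by
  have hm := hg.map (Int.castRingHom (ZMod p))
  have hd := hg.natDegree_map (Int.castRingHom (ZMod p))
  rw [hm.irreducible_iff_roots_eq_zero_of_degree_le_three (hd ▸ h2) (hd ▸ h3)]
  refine Multiset.eq_zero_of_forall_notMem fun a ha => h a ?_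
  rw [← eval_map]
  exact (mem_roots'.1 ha).2

end maximalIdeal

/-! ### Local analysis of the sextic, by divisibility of `A` and `B` -/

section evenSextic

variable {p k : ℕ} {A B : ℤ} {M : Ideal ℤ[X]}

theorem sq_dvd_of_X_mem [Fact p.Prime] (hk : k = 1 ∨ k = 2) (hM : M ≠ ⊤) (hpM : C (p : ℤ) ∈ M)
    (hf : evenSextic A B k ∈ M ^ 2) (hX : X ∈ M) : (p : ℤ) ^ 2 ∣ B := by
  have hirr : Irreducible ((X : ℤ[X]).map (Int.castRingHom (ZMod p))) := by
    rw [map_X]; exact irreducible_X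
  rw [eq_span_pair_of_mem hM hpM hirr hX, evenSextic_eq hk, sq X, mul_assoc] at hf
  simpa using sq_dvd_coeff_of_mem_sq monic_X (by
    rw [degree_X]; exact degree_C_le.trans_lt (by norm_num)) hf 0

theorem sq_dvd_of_X_sub_one_mem [Fact p.Prime] (hM : M ≠ ⊤)
    (hpM : C (p : ℤ) ∈ M) (hf : evenSextic A B k ∈ M ^ 2) (hX : X - C 1 ∈ M) :
    (p : ℤ) ^ 2 ∣ 1 + A + B := by
  have hirr : Irreducible ((X - C 1 : ℤ[X]).map (Int.castRingHom (ZMod p))) := by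
    rw [Polynomial.map_sub, map_X, map_C]; exact irreducible_X_sub_C _
  obtain ⟨q, hq⟩ : ∃ q, evenSextic A B k = (X - C 1) * q + C (1 + A + B) := by
    obtain ⟨q, hq⟩ := X_sub_C_dvd_sub_C_eval (p := evenSextic A B k) (a := 1)
    refine ⟨q, ?_⟩
    rw [← hq]
    simp [evenSextic]
    ring
  rw [eq_span_pair_of_mem hM hpM hirr hX, hq] at hf
  simpa using sq_dvd_coeff_of_mem_sq (monic_X_sub_C 1) (by
    rw [degree_X_sub_C]; exact degree_C_le.trans_lt (by norm_num)) hf 0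

theorem sq_dvd_of_X_add_one_mem [Fact p.Prime] (hM : M ≠ ⊤)
    (hpM : C (p : ℤ) ∈ M) (hf : evenSextic A B k ∈ M ^ 2) (hX : X + C 1 ∈ M) :
    (p : ℤ) ^ 2 ∣ 1 + A + B := by
  have hirr : Irreducible ((X + C 1 : ℤ[X]).map (Int.castRingHom (ZMod p))) := by
    rw [Polynomial.map_add, map_X, map_C, ← sub_neg_eq_add, ← C_neg]; exact irreducible_X_sub_C _
  obtain ⟨q, hq⟩ : ∃ q, evenSextic A B k = (X + C 1) * q + C (1 + A + B) := by
    -- The sextic is even, so its value at `-1` is again `1 + A + B`.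
    obtain ⟨q, hq⟩ := X_sub_C_dvd_sub_C_eval (p := evenSextic A B k) (a := -1)
    refine ⟨q, ?_⟩
    rw [C_neg, sub_neg_eq_add] at hq
    rw [← hq]
    simp [evenSextic, pow_mul]
    ring
  rw [eq_span_pair_of_mem hM hpM hirr hX, hq] at hf
  simpa using sq_dvd_coeff_of_mem_sq (monic_X_add_C 1) (by
    rw [degree_X_add_C]; exact degree_C_le.trans_lt (by norm_num)) hf 0

theorem notMem_sq_of_dvd_of_dvd [Fact p.Prime] (hk : k = 1 ∨ k = 2) (hA : (p : ℤ) ∣ A)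
    (hB : (p : ℤ) ∣ B) (hB2 : ¬ (p : ℤ) ^ 2 ∣ B) (hM : M.IsMaximal) (hpM : C (p : ℤ) ∈ M) :
    evenSextic A B k ∉ M ^ 2 := by
  intro hf
  obtain ⟨a, rfl⟩ := hA
  obtain ⟨b, rfl⟩ := hB
  refine hB2 (sq_dvd_of_X_mem hk hM.ne_top hpM hf (hM.isPrime.mem_of_pow_mem 6 ?_))
  refine mem_of_eq_add hpM (Ideal.pow_le_self two_ne_zero hf) (c := -(C a * X ^ (2 * k) + C b)) ?_
  simp only [evenSextic, map_mul]
  ring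

theorem exists_mem_sq_of_sq_dvd (hk : k = 1 ∨ k = 2) (hB : (p : ℤ) ^ 2 ∣ B) :
    ∃ g : ℤ[X], g.Monic ∧ 0 < g.natDegree ∧
      evenSextic A B k ∈ Ideal.span {C (p : ℤ), g} ^ 2 := by
  obtain ⟨b, rfl⟩ := hB
  refine ⟨X, monic_X, by simp, Ideal.mem_span_pair_sq.2
    ⟨X ^ 4 + C A * X ^ (2 * k - 2), 0, C b, ?_⟩⟩
  rw [evenSextic_eq hk, map_mul, map_pow]
  ring

/-- Taylor expansion at 1: the hypotheses say `p ∣ f'(1)` and `p ^ 2 ∣ f(1)`. -/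
theorem exists_mem_sq_of_sq_dvd_one_add (hk : k = 1 ∨ k = 2) (h1 : (p : ℤ) ∣ 6 + 2 * k * A)
    (h2 : (p : ℤ) ^ 2 ∣ 1 + A + B) :
    ∃ g : ℤ[X], g.Monic ∧ 0 < g.natDegree ∧
      evenSextic A B k ∈ Ideal.span {C (p : ℤ), g} ^ 2 := by
  obtain ⟨c, hc⟩ := h2
  obtain ⟨b, hb⟩ := h1
  obtain rfl : B = p ^ 2 * c - 1 - A := by linarith
  have hb' := congrArg (C : ℤ → ℤ[X]) hb
  refine ⟨X - C 1, monic_X_sub_C 1, by rw [natDegree_X_sub_C]; norm_num, ?_⟩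
  rw [Ideal.mem_span_pair_sq]
  rcases hk with rfl | rfl
  · refine ⟨X ^ 4 + 2 * X ^ 3 + 3 * X ^ 2 + 4 * X + 5 + C A, C b, C c, ?_⟩
    simp only [evenSextic, map_mul, map_add, map_sub, map_pow, map_ofNat, map_one, Nat.cast_one,
      mul_one] at hb' ⊢
    linear_combination (X - 1) * hb'
  · refine ⟨X ^ 4 + 2 * X ^ 3 + 3 * X ^ 2 + 4 * X + 5 + C A * (X ^ 2 + 2 * X + 3), C b, C c, ?_⟩
    simp only [evenSextic, map_mul, map_add, map_sub, map_pow, map_ofNat, map_one,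
      Nat.cast_ofNat] at hb' ⊢
    linear_combination (X - 1) * hb'

/-- Modulo 2, `f ≡ ((X - 1)(X² + X + 1))²`; the remainder of `f` is tested at each factor. -/
theorem notMem_sq_two_of_even_odd (hk : k = 1 ∨ k = 2)
    (hAB : A % 4 = 0 ∧ B % 4 = 1 ∨ A % 4 = 2 ∧ B % 4 = 3) (hM : M.IsMaximal)
    (hpM : C ((2 : ℕ) : ℤ) ∈ M) : evenSextic A B k ∉ M ^ 2 := by
  intro hf
  have hf1 := Ideal.pow_le_self two_ne_zero hf
  obtain ⟨a, ha⟩ : ∃ a, A = 2 * a := ⟨A / 2, by omega⟩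
  obtain ⟨b, hb⟩ : ∃ b, B = 2 * b + 1 := ⟨B / 2, by omega⟩
  have hprod : ((X - C 1) * (X ^ 2 + X + 1)) ∈ M := by
    refine hM.isPrime.mem_of_pow_mem 2 (mem_of_eq_add hpM hf1
      (c := -(X ^ 3 + C a * X ^ (2 * k) + C b)) ?_)
    simp only [evenSextic, ha, hb, map_mul, map_add, map_ofNat, map_one, Nat.cast_ofNat]
    ring
  rcases hM.isPrime.mem_or_mem hprod with h | h
  · have := sq_dvd_of_X_sub_one_mem hM.ne_top hpM hf h
    push_cast at this
    omega
  · have hm : (X ^ 2 + X + 1 : ℤ[X]).Monic := by monicity!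
    have hd : (X ^ 2 + X + 1 : ℤ[X]).natDegree = 2 := by compute_degree!
    have hirr := irreducible_map_of_eval_ne_zero (p := 2) hm (by omega) (by omega) (by
      simp only [eval₂_add, eval₂_X_pow, eval₂_X, eval₂_one]; decide)
    rw [eq_span_pair_of_mem hM.ne_top hpM hirr h] at hf
    have key : ∀ q (u v : ℤ), evenSextic A B k = (X ^ 2 + X + 1) * q + (C u * X + C v) →
        4 ∣ u ∧ 4 ∣ v := by
      intro q u v hq
      rw [hq] at hf
      have := sq_dvd_coeff_of_mem_sq hm (by
        rw [degree_eq_natDegree hm.ne_zero, hd]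
        exact degree_linear_le.trans_lt (by norm_num)) hf
      exact ⟨by simpa [coeff_C, -eq_intCast] using this 1, by simpa using this 0⟩
    rcases hk with rfl | rfl
    · have := key ((X - 1) * (X ^ 3 + 1) + C A) (-A) (1 + B - A) (by
        simp only [evenSextic, map_add, map_sub, map_neg, map_one]; ring)
      omega
    · have := key ((X - 1) * (X ^ 3 + 1) + C A * (X ^ 2 - X)) A (1 + B) (by
        simp only [evenSextic, map_add, map_one]; ring)
      omega

theorem exists_mem_sq_two_of_even_odd (hk : k = 1 ∨ k = 2) (hA : 2 ∣ A) (hB : ¬ 2 ∣ B)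
    (hAB : ¬ (A % 4 = 0 ∧ B % 4 = 1 ∨ A % 4 = 2 ∧ B % 4 = 3)) :
    ∃ g : ℤ[X], g.Monic ∧ 0 < g.natDegree ∧
      evenSextic A B k ∈ Ideal.span {C ((2 : ℕ) : ℤ), g} ^ 2 := by
  by_cases h : 4 ∣ 1 + A + B
  · exact exists_mem_sq_of_sq_dvd_one_add hk ⟨3 + k * A, by push_cast; ring⟩ (by simpa using h)
  · omega

/-- Modulo 3, `f` is the cube of `X² + 1`, which is irreducible, or of `(X - 1)(X + 1)`, according
to `B`. The numbers tested are the values of `f` at `X² = -1` and at `X = ±1`. -/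
theorem notMem_sq_three (hk : k = 1 ∨ k = 2) (hA : 3 ∣ A) (hB : ¬ 3 ∣ B)
    (h2 : B % 3 = 2 → ¬ 9 ∣ 1 + A + B) (h1 : B % 3 = 1 → ¬ 9 ∣ B - 1 + (-1) ^ k * A)
    (hM : M.IsMaximal) (hpM : C ((3 : ℕ) : ℤ) ∈ M) : evenSextic A B k ∉ M ^ 2 := by
  intro hf
  have hf1 := Ideal.pow_le_self two_ne_zero hf
  obtain ⟨a, ha⟩ := hA
  obtain hB1 | hB2 : B % 3 = 1 ∨ B % 3 = 2 := by omega
  · obtain ⟨b, hb⟩ : ∃ b, B = 3 * b + 1 := ⟨B / 3, by omega⟩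
    have h : (X ^ 2 + 1 : ℤ[X]) ∈ M := by
      refine hM.isPrime.mem_of_pow_mem 3 (mem_of_eq_add hpM hf1
        (c := X ^ 4 + X ^ 2 - (C a * X ^ (2 * k) + C b)) ?_)
      simp only [evenSextic, ha, hb, map_mul, map_add, map_ofNat, map_one, Nat.cast_ofNat]
      ring
    have hm : (X ^ 2 + 1 : ℤ[X]).Monic := by monicity!
    have hd : (X ^ 2 + 1 : ℤ[X]).natDegree = 2 := by compute_degree!
    have hirr := irreducible_map_of_eval_ne_zero (p := 3) hm (by omega) (by omega) (by
      simp only [eval₂_add, eval₂_X_pow, eval₂_one]; decide)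
    rw [eq_span_pair_of_mem hM.ne_top hpM hirr h] at hf
    have key : ∀ q (v : ℤ), evenSextic A B k = (X ^ 2 + 1) * q + C v → 9 ∣ v := by
      intro q v hq
      rw [hq] at hf
      have := sq_dvd_coeff_of_mem_sq hm (by
        rw [degree_eq_natDegree hm.ne_zero, hd]
        exact degree_C_le.trans_lt (by norm_num)) hf 0
      simpa using this
    rcases hk with rfl | rfl
    · refine h1 hB1 (key (X ^ 4 - X ^ 2 + 1 + C A) _ ?_)
      simp only [evenSextic, map_add, map_sub, map_one, map_mul, map_pow, map_neg]; ring
    · refine h1 hB1 (key (X ^ 4 - X ^ 2 + 1 + C A * (X ^ 2 - 1)) _ ?_)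
      simp only [evenSextic, map_add, map_sub, map_one, map_mul, map_pow, map_neg]; ring
  · obtain ⟨b, hb⟩ : ∃ b, B = 3 * b - 1 := ⟨(B + 1) / 3, by omega⟩
    have hprod : ((X - C 1) * (X + C 1) : ℤ[X]) ∈ M := by
      refine hM.isPrime.mem_of_pow_mem 3 (mem_of_eq_add hpM hf1
        (c := - X ^ 4 + X ^ 2 - (C a * X ^ (2 * k) + C b)) ?_)
      simp only [evenSextic, ha, hb, map_mul, map_sub, map_ofNat, map_one, Nat.cast_ofNat]
      ring
    refine h2 hB2 ?_
    rcases hM.isPrime.mem_or_mem hprod with h | h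
    · simpa using sq_dvd_of_X_sub_one_mem hM.ne_top hpM hf h
    · simpa using sq_dvd_of_X_add_one_mem hM.ne_top hpM hf h

theorem exists_mem_sq_three (hk : k = 1 ∨ k = 2) (hA : 3 ∣ A)
    (h : 9 ∣ 1 + A + B ∨ 9 ∣ B - 1 + (-1) ^ k * A) :
    ∃ g : ℤ[X], g.Monic ∧ 0 < g.natDegree ∧
      evenSextic A B k ∈ Ideal.span {C ((3 : ℕ) : ℤ), g} ^ 2 := by
  obtain ⟨a, rfl⟩ := hA
  rcases h with h | ⟨c, hc⟩
  · exact exists_mem_sq_of_sq_dvd_one_add hk ⟨2 + 2 * k * a, by push_cast; ring⟩ (by simpa using h)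
  · refine ⟨X ^ 2 + 1, by monicity!, ?_, ?_⟩
    · have : (X ^ 2 + 1 : ℤ[X]).natDegree = 2 := by compute_degree!
      omega
    · rw [Ideal.mem_span_pair_sq]
      have hc' := congrArg (C : ℤ → ℤ[X]) hc
      rcases hk with rfl | rfl
      · refine ⟨X ^ 2 - 2, 1 + C a, C c, ?_⟩
        simp only [evenSextic, map_add, map_sub, map_one, map_mul, map_pow, map_neg, map_ofNat,
          Nat.cast_ofNat] at hc' ⊢
        linear_combination hc'
      · refine ⟨X ^ 2 - 2 + 3 * C a, 1 - 2 * C a, C c, ?_⟩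
        simp only [evenSextic, map_add, map_sub, map_one, map_mul, map_pow, map_neg, map_ofNat,
          Nat.cast_ofNat] at hc' ⊢
        linear_combination hc'

theorem notMem_sq_of_not_dvd_of_dvd [Fact p.Prime] (hk : k = 1 ∨ k = 2) (h2 : p ≠ 2)
    (hA : ¬ (p : ℤ) ∣ A) (hB : (p : ℤ) ∣ B) (hB2 : ¬ (p : ℤ) ^ 2 ∣ B) (hM : M.IsMaximal)
    (hpM : C (p : ℤ) ∈ M) : evenSextic A B k ∉ M ^ 2 := by
  intro hf
  have hp : p.Prime := Fact.out
  have hf1 := Ideal.pow_le_self two_ne_zero hf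
  have hX : X ∉ M := fun hX => hB2 (sq_dvd_of_X_mem hk hM.ne_top hpM hf hX)
  have hder := derivative_mem_of_mem_sq hf
  have hBM := (C_mem_iff_dvd hp hM.ne_top hpM).2 hB
  have h2M : C (2 : ℤ) ∉ M := by
    rw [C_mem_iff_dvd hp hM.ne_top hpM]
    exact fun h => h2 ((Nat.prime_dvd_prime_iff_eq hp Nat.prime_two).1 (by exact_mod_cast h))
  -- Away from `X` and 2, eliminating the power of `X` between `f` and `f'` modulo `p` leaves `2A`
  -- or `A`.
  have key : C A ∈ M := by
    rcases hk with rfl | rfl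
    · have e1 : X ^ 2 * (X ^ 4 + C A) ∈ M := by
        refine mem_of_eq_add hBM hf1 (c := -1) ?_
        simp only [evenSextic]; ring
      have e2 : C 2 * (X * (3 * X ^ 4 + C A)) ∈ M := by
        convert hder using 1
        simp only [evenSextic, derivative_add, derivative_mul, derivative_X_pow, derivative_C]
        simp
        ring
      have e1' := (hM.isPrime.mem_or_mem e1).resolve_left fun h => hX (hM.isPrime.mem_of_pow_mem _ h)
      have e2' := (hM.isPrime.mem_or_mem ((hM.isPrime.mem_or_mem e2).resolve_left h2M)).resolve_left hX
      refine (hM.isPrime.mem_or_mem ?_).resolve_left h2M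
      have e3 := sub_mem (M.mul_mem_left 3 e1') e2'
      convert e3 using 1
      simp only [map_ofNat]
      ring
    · have e1 : X ^ 4 * (X ^ 2 + C A) ∈ M := by
        refine mem_of_eq_add hBM hf1 (c := -1) ?_
        simp only [evenSextic]; ring
      have e2 : C 2 * (X ^ 3 * (3 * X ^ 2 + 2 * C A)) ∈ M := by
        convert hder using 1
        simp only [evenSextic, derivative_add, derivative_mul, derivative_X_pow, derivative_C]
        simp
        ring
      have e1' := (hM.isPrime.mem_or_mem e1).resolve_left fun h => hX (hM.isPrime.mem_of_pow_mem _ h)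
      have e2' := (hM.isPrime.mem_or_mem ((hM.isPrime.mem_or_mem e2).resolve_left h2M)).resolve_left
        fun h => hX (hM.isPrime.mem_of_pow_mem _ h)
      have e3 := sub_mem (M.mul_mem_left 3 e1') e2'
      convert e3 using 1
      ring
  exact hA ((C_mem_iff_dvd hp hM.ne_top hpM).1 key)

theorem notMem_sq_two_of_odd_even (hk : k = 1 ∨ k = 2) (hA : A % 4 = 3) (hB : B % 4 = 2)
    (hM : M.IsMaximal) (hpM : C ((2 : ℕ) : ℤ) ∈ M) : evenSextic A B k ∉ M ^ 2 := by
  intro hf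
  have hf1 := Ideal.pow_le_self two_ne_zero hf
  obtain ⟨a, ha⟩ : ∃ a, A = 2 * a + 1 := ⟨A / 2, by omega⟩
  obtain ⟨b, hb⟩ : ∃ b, B = 2 * b := ⟨B / 2, by omega⟩
  have hor : (X : ℤ[X]) ∈ M ∨ (X - C 1 : ℤ[X]) ∈ M := by
    rcases hk with rfl | rfl
    · have : (X ^ 2 * (X - C 1) ^ 4 : ℤ[X]) ∈ M := by
        refine mem_of_eq_add hpM hf1
          (c := -2 * X ^ 5 + 3 * X ^ 4 - 2 * X ^ 3 - C a * X ^ 2 - C b) ?_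
        simp only [evenSextic, ha, hb, map_mul, map_add, map_ofNat, map_one, Nat.cast_ofNat]
        ring
      exact (hM.isPrime.mem_or_mem this).imp (hM.isPrime.mem_of_pow_mem 2)
        (hM.isPrime.mem_of_pow_mem 4)
    · have : (X ^ 4 * (X - C 1) ^ 2 : ℤ[X]) ∈ M := by
        refine mem_of_eq_add hpM hf1 (c := -X ^ 5 - C a * X ^ 4 - C b) ?_
        simp only [evenSextic, ha, hb, map_mul, map_add, map_ofNat, map_one, Nat.cast_ofNat]
        ring
      exact (hM.isPrime.mem_or_mem this).imp (hM.isPrime.mem_of_pow_mem 4)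
        (hM.isPrime.mem_of_pow_mem 2)
  rcases hor with h | h
  · have := sq_dvd_of_X_mem hk hM.ne_top hpM hf h
    push_cast at this
    omega
  · have := sq_dvd_of_X_sub_one_mem hM.ne_top hpM hf h
    push_cast at this
    omega

/-- Modulo 2, `f` is the square of the irreducible cubic `X³ + X^k + 1`. The remainder is never
divisible by 4: for `k = 1` its `X` coefficient is 2, for `k = 2` its two top coefficients add up to
2. -/
theorem notMem_sq_two_of_odd_odd (hk : k = 1 ∨ k = 2) (hA : ¬ 2 ∣ A) (hB : ¬ 2 ∣ B)
    (hM : M.IsMaximal) (hpM : C ((2 : ℕ) : ℤ) ∈ M) : evenSextic A B k ∉ M ^ 2 := by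
  intro hf
  have hf1 := Ideal.pow_le_self two_ne_zero hf
  obtain ⟨a, ha⟩ : ∃ a, A = 2 * a + 1 := ⟨A / 2, by omega⟩
  obtain ⟨b, hb⟩ : ∃ b, B = 2 * b + 1 := ⟨B / 2, by omega⟩
  have h : (X ^ 3 + X ^ k + 1 : ℤ[X]) ∈ M := by
    refine hM.isPrime.mem_of_pow_mem 2 (mem_of_eq_add hpM hf1
      (c := X ^ 3 * X ^ k + X ^ 3 + X ^ k - (C a * X ^ (2 * k) + C b)) ?_)
    simp only [evenSextic, ha, hb, map_mul, map_add, map_ofNat, map_one, Nat.cast_ofNat]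
    ring
  have hm : (X ^ 3 + X ^ k + 1 : ℤ[X]).Monic := by
    rcases hk with rfl | rfl <;> monicity!
  have hd : (X ^ 3 + X ^ k + 1 : ℤ[X]).natDegree = 3 := by
    rcases hk with rfl | rfl <;> compute_degree!
  have hirr := irreducible_map_of_eval_ne_zero (p := 2) hm (by omega) (by omega) (by
      simp only [eval₂_add, eval₂_X_pow, eval₂_one]
      rcases hk with rfl | rfl <;> decide)
  rw [eq_span_pair_of_mem hM.ne_top hpM hirr h] at hf
  have key : ∀ q (t u v : ℤ), evenSextic A B k =
      (X ^ 3 + X ^ k + 1) * q + (C t * X ^ 2 + C u * X + C v) → 4 ∣ t ∧ 4 ∣ u := by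
    intro q t u v hq
    rw [hq] at hf
    have := sq_dvd_coeff_of_mem_sq hm (by
      rw [degree_eq_natDegree hm.ne_zero, hd]
      exact degree_quadratic_le.trans_lt (by norm_num)) hf
    exact ⟨by simpa [coeff_X, coeff_C, -eq_intCast] using this 2,
      by simpa [coeff_X, coeff_C, -eq_intCast] using this 1⟩
  rcases hk with rfl | rfl
  · have := key (X ^ 3 - X - 1) (A + 1) 2 (1 + B) (by
      simp only [evenSextic, map_add, map_ofNat, map_one]; ring)
    omega
  · have := key ((X ^ 3 - X ^ 2 - 1) + (X - 1) * (1 + C A)) (3 + A) (-(1 + A)) (2 + A + B) (by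
      simp only [evenSextic, map_add, map_neg, map_ofNat, map_one]; ring)
    omega

theorem C_mul_evenSextic_one (A B : ℤ) : C (8 * A ^ 3) * evenSextic A B 1 =
    (C (2 * A) * X ^ 2 + C (3 * B)) ^ 2 * (C (2 * A) * X ^ 2 - C (6 * B)) +
      C (sexticDelta A B 1) * (C (2 * A) * X ^ 2 + C (3 * B)) - C (B * sexticDelta A B 1) := by
  simp only [evenSextic, sexticDelta, map_add, map_mul, map_pow, map_ofNat]
  ring

theorem C_mul_evenSextic_two (A B : ℤ) : C 27 * evenSextic A B 2 =
    (C 3 * X ^ 2 + C (2 * A)) ^ 2 * (C 3 * X ^ 2 - C A) + C (sexticDelta A B 2) := by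
  simp only [evenSextic, sexticDelta, map_add, map_mul, map_pow, map_ofNat]
  ring

/-- If `f ∈ M ^ 2`, then `f` and `f'` in `M` force the quadratic factor into `M`. The preceding
identities then put `Bδ` or `δ` in `M ^ 2`, whose integers are divisible by `p ^ 2`. -/
theorem notMem_sq_of_not_sq_dvd_sexticDelta [Fact p.Prime] (hk : k = 1 ∨ k = 2)
    (h2 : ¬ (p : ℤ) ∣ 2) (hB : ¬ (p : ℤ) ∣ B) (hδ : (p : ℤ) ∣ sexticDelta A B k)
    (hδ2 : ¬ (p : ℤ) ^ 2 ∣ sexticDelta A B k)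
    (hM : M.IsMaximal) (hpM : C (p : ℤ) ∈ M) : evenSextic A B k ∉ M ^ 2 := by
  intro hf
  have hp : p.Prime := Fact.out
  have hf1 := Ideal.pow_le_self two_ne_zero hf
  have hder := derivative_mem_of_mem_sq hf
  have hδM := (C_mem_iff_dvd hp hM.ne_top hpM).2 hδ
  have h2M : C (2 : ℤ) ∉ M := by rwa [C_mem_iff_dvd hp hM.ne_top hpM]
  have hX : X ∉ M := fun hX => by
    refine hB ((C_mem_iff_dvd hp hM.ne_top hpM).1 (mem_of_eq_add hX hf1
      (c := -X * (X ^ 4 + C A * X ^ (2 * k - 2))) ?_))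
    rw [evenSextic_eq hk]; ring
  have sq_mem : ∀ {a b : ℤ[X]}, a ∈ M → b ∈ M → a * b ∈ M ^ 2 := fun ha hb =>
    sq M ▸ Ideal.mul_mem_mul ha hb
  rcases hk with rfl | rfl
  · have e2 : C 2 * (X * (3 * X ^ 4 + C A)) ∈ M := by
      convert hder using 1
      simp only [evenSextic, derivative_add, derivative_mul, derivative_X_pow, derivative_C]
      simp
      ring
    have e2' := (hM.isPrime.mem_or_mem ((hM.isPrime.mem_or_mem e2).resolve_left h2M)).resolve_left hX
    have hs : C (2 * A) * X ^ 2 + C (3 * B) ∈ M := by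
      convert sub_mem (M.mul_mem_left 3 hf1) (M.mul_mem_left (X ^ 2) e2') using 1
      simp only [evenSextic, map_mul, map_ofNat]
      ring
    have : C (B * sexticDelta A B 1) ∈ M ^ 2 := by
      rw [show C (B * sexticDelta A B 1) = (C (2 * A) * X ^ 2 + C (3 * B)) ^ 2 *
        (C (2 * A) * X ^ 2 - C (6 * B)) + C (sexticDelta A B 1) *
        (C (2 * A) * X ^ 2 + C (3 * B)) - C (8 * A ^ 3) * evenSextic A B 1 by
          rw [C_mul_evenSextic_one]; ring]
      exact sub_mem (add_mem (Ideal.mul_mem_right _ _ (Ideal.pow_mem_pow hs 2)) (sq_mem hδM hs))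
        (Ideal.mul_mem_left _ _ hf)
    refine hδ2 (IsCoprime.dvd_of_dvd_mul_left ?_ (sq_dvd_of_C_mem_sq hM.ne_top hpM this))
    exact ((Nat.prime_iff_prime_int.1 hp).coprime_iff_not_dvd.2 hB).pow_left
  · have e2 : C 2 * (X ^ 3 * (C 3 * X ^ 2 + C (2 * A))) ∈ M := by
      convert hder using 1
      simp only [evenSextic, derivative_add, derivative_mul, derivative_X_pow, derivative_C]
      simp
      ring
    have e2' := (hM.isPrime.mem_or_mem ((hM.isPrime.mem_or_mem e2).resolve_left h2M)).resolve_left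
      fun h => hX (hM.isPrime.mem_of_pow_mem _ h)
    refine hδ2 (sq_dvd_of_C_mem_sq hM.ne_top hpM ?_)
    rw [show C (sexticDelta A B 2) = C 27 * evenSextic A B 2 -
      (C 3 * X ^ 2 + C (2 * A)) ^ 2 * (C 3 * X ^ 2 - C A) by rw [C_mul_evenSextic_two]; ring]
    exact sub_mem (Ideal.mul_mem_left _ _ hf) (Ideal.mul_mem_right _ _ (Ideal.pow_mem_pow e2' 2))

/-- An integer prime to `p` is invertible modulo `p ^ 2`, which lies in `I ^ 2`. -/
theorem mem_sq_of_C_mul_mem_sq (hp : p.Prime) {I : Ideal ℤ[X]} (hpI : C (p : ℤ) ∈ I) {n : ℤ}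
    (hn : ¬ (p : ℤ) ∣ n) {f : ℤ[X]} (h : C n * f ∈ I ^ 2) : f ∈ I ^ 2 := by
  obtain ⟨a, b, hab⟩ := ((Nat.prime_iff_prime_int.1 hp).coprime_iff_not_dvd.2 hn).pow_left (m := 2)
  have : f = C a * f * C (p : ℤ) ^ 2 + C b * (C n * f) := by
    have := congrArg (C : ℤ → ℤ[X]) hab
    simp only [map_add, map_mul, map_pow, map_one] at this
    linear_combination (-f) * this
  rw [this]
  exact add_mem (Ideal.mul_mem_left _ _ (Ideal.pow_mem_pow hpI 2)) (Ideal.mul_mem_left _ _ h)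

/-- Modulo `p`, a quadratic `u X ^ 2 + v` with `u` invertible is a multiple of a monic one. -/
theorem exists_monic_quadratic_mem_span (hp : p.Prime) {u : ℤ} (hu : ¬ (p : ℤ) ∣ u) (v : ℤ) :
    ∃ g : ℤ[X], g.Monic ∧ 0 < g.natDegree ∧
      C u * X ^ 2 + C v ∈ Ideal.span {C (p : ℤ), g} := by
  obtain ⟨a, b, hab⟩ := (Nat.prime_iff_prime_int.1 hp).coprime_iff_not_dvd.2 hu
  refine ⟨X ^ 2 + C (b * v), by monicity!, ?_, Ideal.mem_span_pair.2 ⟨C (a * v), C u, ?_⟩⟩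
  · have : (X ^ 2 + C (b * v) : ℤ[X]).natDegree = 2 := by compute_degree!
    omega
  · have := congrArg (C : ℤ → ℤ[X]) hab
    simp only [map_add, map_mul, map_one] at this ⊢
    linear_combination C v * this

theorem exists_mem_sq_of_sq_dvd_sexticDelta (hp : p.Prime) (hk : k = 1 ∨ k = 2)
    (h2 : ¬ (p : ℤ) ∣ 2) (h3 : ¬ (p : ℤ) ∣ 3) (hA : ¬ (p : ℤ) ∣ A)
    (hδ : (p : ℤ) ^ 2 ∣ sexticDelta A B k) :
    ∃ g : ℤ[X], g.Monic ∧ 0 < g.natDegree ∧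
      evenSextic A B k ∈ Ideal.span {C (p : ℤ), g} ^ 2 := by
  have hpz := Nat.prime_iff_prime_int.1 hp
  obtain ⟨d, hd⟩ := hδ
  have hmem : ∀ g : ℤ[X], C (sexticDelta A B k) ∈ Ideal.span {C (p : ℤ), g} ^ 2 := fun g => by
    rw [hd, map_mul, map_pow]
    exact Ideal.mul_mem_right _ _ (Ideal.pow_mem_pow (Ideal.subset_span (by simp)) 2)
  rcases hk with rfl | rfl
  · obtain ⟨g, hg, hg0, h⟩ := exists_monic_quadratic_mem_span hp
      (u := 2 * A) (fun h => (hpz.dvd_or_dvd h).elim h2 hA) (3 * B)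
    refine ⟨g, hg, hg0, mem_sq_of_C_mul_mem_sq hp (Ideal.subset_span (by simp))
      (n := 8 * A ^ 3) ?_ ?_⟩
    · rw [show 8 * A ^ 3 = (2 * A) ^ 3 by ring]
      exact fun h => (hpz.dvd_or_dvd (hpz.dvd_of_dvd_pow h)).elim h2 hA
    · rw [C_mul_evenSextic_one, C_mul (a := B)]
      exact sub_mem (add_mem (Ideal.mul_mem_right _ _ (Ideal.pow_mem_pow h 2))
        (Ideal.mul_mem_right _ _ (hmem g))) (Ideal.mul_mem_left _ _ (hmem g))
  · obtain ⟨g, hg, hg0, h⟩ := exists_monic_quadratic_mem_span hp h3 (2 * A)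
    refine ⟨g, hg, hg0, mem_sq_of_C_mul_mem_sq hp (Ideal.subset_span (by simp)) (n := 27) ?_ ?_⟩
    · rw [show (27 : ℤ) = 3 ^ 3 by norm_num]
      exact fun h => h3 (hpz.dvd_of_dvd_pow h)
    · rw [C_mul_evenSextic_two]
      exact add_mem (Ideal.mul_mem_right _ _ (Ideal.pow_mem_pow h 2)) (hmem g)

end evenSextic

/-! ### Assembly of the cases -/

theorem mem_residuePairs_iff {k : ℕ} (hk : k = 1 ∨ k = 2) {A B : ℤ} (hA : 3 ∣ A) (hB : ¬ 3 ∣ B) :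
    (A % 9, B % 9) ∈ residuePairs k ↔
      (B % 3 = 2 → ¬ 9 ∣ 1 + A + B) ∧ (B % 3 = 1 → ¬ 9 ∣ B - 1 + (-1) ^ k * A) := by
  have hA' : A % 9 = 0 ∨ A % 9 = 3 ∨ A % 9 = 6 := by omega
  have hB' : B % 9 = 1 ∨ B % 9 = 2 ∨ B % 9 = 4 ∨ B % 9 = 5 ∨ B % 9 = 7 ∨ B % 9 = 8 := by omega
  simp only [residuePairs, Set.mem_insert_iff, Set.mem_singleton_iff, Prod.mk.injEq]
  rcases hk with rfl | rfl <;> rcases hA' with hA' | hA' | hA' <;>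
    rcases hB' with hB' | hB' | hB' | hB' | hB' | hB' <;> rw [hA', hB'] <;> norm_num <;> omega

theorem discr_evenSextic {k : ℕ} (hk : k = 1 ∨ k = 2) {A B : ℤ} (hA : A ≠ 0) :
    (evenSextic A B k).discr = -64 * B ^ (2 * k - 1) * sexticDelta A B k ^ 2 := by
  rcases hk with rfl | rfl
  · simpa using discr_evenSextic_one B hA
  · exact discr_evenSextic_two A B

theorem theorem2p7 (k : ℕ) (hk : k = 1 ∨ k = 2) (A B : ℤ) (hAB : A * B ≠ 0)
    (hirr : Irreducible ((evenSextic A B k).map (Int.castRingHom ℚ))) :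
    (evenSextic A B k).discr = -64 * B ^ (2 * k - 1) * sexticDelta A B k ^ 2 ∧
    ∀ (K : Type*) [Field K] [NumberField K] (θ : K),
      aeval θ (evenSextic A B k) = 0 → IntermediateField.adjoin ℚ {θ} = ⊤ →
      ∀ p : ℕ, p.Prime → (p : ℤ) ∣ (evenSextic A B k).discr →
        (¬ p ∣ integersIndex θ ↔
          ((p : ℤ) ∣ A ∧ (p : ℤ) ∣ B ∧ ¬ (p : ℤ) ^ 2 ∣ B) ∨
          ((p : ℤ) ∣ A ∧ ¬ (p : ℤ) ∣ B ∧
            ((p = 2 ∧ (A % 4, B % 4) ∈ ({(0, 1), (2, 3)} : Set (ℤ × ℤ))) ∨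
             (p = 3 ∧ (A % 9, B % 9) ∈ residuePairs k))) ∨
          (¬ (p : ℤ) ∣ A ∧ (p : ℤ) ∣ B ∧
            ((p ≠ 2 ∧ ¬ (p : ℤ) ^ 2 ∣ B) ∨
             (p = 2 ∧ (A % 4, B % 4) = (3, 2)))) ∨
          (p = 2 ∧ ¬ (2 : ℤ) ∣ A * B) ∨
          (¬ (p : ℤ) ∣ 2 * A * B ∧ ¬ (p : ℤ) ^ 2 ∣ sexticDelta A B k)) := by
  have hdisc := discr_evenSextic (B := B) hk (left_ne_zero_of_mul hAB)
  refine ⟨hdisc, ?_⟩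
  intro K _ _ θ h0 hθ p hp hpd
  have := Fact.mk hp
  have hpz := Nat.prime_iff_prime_int.1 hp
  rw [hdisc] at hpd
  have hreg : (∀ M : Ideal ℤ[X], M.IsMaximal → C (p : ℤ) ∈ M → evenSextic A B k ∉ M ^ 2) →
      ¬ p ∣ integersIndex θ := not_dvd_integersIndex h0 hθ hp
  have hsing : (∃ g : ℤ[X], g.Monic ∧ 0 < g.natDegree ∧
      evenSextic A B k ∈ Ideal.span {C (p : ℤ), g} ^ 2) → p ∣ integersIndex θ :=
    fun ⟨g, hg, hg0, h⟩ => dvd_integersIndex (monic_evenSextic hk A B) hirr h0 hp hg hg0 h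
  have hdvd : ∀ {q : ℕ}, q.Prime → (p : ℤ) ∣ q → p = q := fun hq h =>
    (Nat.prime_dvd_prime_iff_eq hp hq).1 (by exact_mod_cast h)
  have hδ : ¬ (p : ℤ) ∣ 2 → ¬ (p : ℤ) ∣ B → (p : ℤ) ∣ sexticDelta A B k := fun h2 hB => by
    refine hpz.dvd_of_dvd_pow ((hpz.dvd_or_dvd hpd).resolve_left fun h => ?_)
    rcases hpz.dvd_or_dvd h with h | h
    · rw [show (-64 : ℤ) = -2 ^ 6 by norm_num, dvd_neg] at h
      exact h2 (hpz.dvd_of_dvd_pow h)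
    · exact hB (hpz.dvd_of_dvd_pow h)
  by_cases hA : (p : ℤ) ∣ A <;> by_cases hB : (p : ℤ) ∣ B
  · have h5 : (p : ℤ) ∣ 2 * A * B := hB.mul_left _
    have h4 : p = 2 → (2 : ℤ) ∣ A * B := by rintro rfl; exact hB.mul_left _
    have h4' : ¬ (p = 2 ∧ ¬ (2 : ℤ) ∣ A * B) := fun h => h.2 (h4 h.1)
    simp only [hA, hB, h5, h4', not_true_eq_false, true_and, false_and, and_false, or_false]
    by_cases hB2 : (p : ℤ) ^ 2 ∣ B
    · have := hsing (exists_mem_sq_of_sq_dvd hk hB2)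
      exact iff_of_false (not_not.2 this) (not_not.2 hB2)
    · have := hreg fun M hM hpM => notMem_sq_of_dvd_of_dvd hk hA hB hB2 hM hpM
      exact iff_of_true this hB2
  · have h5 : (p : ℤ) ∣ 2 * A * B := (hA.mul_left _).mul_right _
    have h4 : p = 2 → (2 : ℤ) ∣ A * B := by rintro rfl; exact hA.mul_right _
    have h4' : ¬ (p = 2 ∧ ¬ (2 : ℤ) ∣ A * B) := fun h => h.2 (h4 h.1)
    simp only [hA, hB, h5, h4', not_true_eq_false, not_false_eq_true, true_and, false_and, or_false,
      false_or]
    -- For odd `p`, `p ∣ δ` and `p ∣ A` leave `p ∣ 27 B ^ (3 - k)`.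
    obtain rfl | rfl : p = 2 ∨ p = 3 := by
      by_contra! hcon
      have h2 : ¬ (p : ℤ) ∣ 2 := fun h => hcon.1 (hdvd Nat.prime_two h)
      have h27 : (p : ℤ) ∣ 3 ^ 3 * B ^ (3 - k) := by
        have h := hδ h2 hB
        rw [sexticDelta, dvd_add_right ((hA.pow three_ne_zero).mul_left _)] at h
        exact h
      rcases hpz.dvd_or_dvd h27 with h | h
      · exact hcon.2 (hdvd Nat.prime_three (hpz.dvd_of_dvd_pow h))
      · exact hB (hpz.dvd_of_dvd_pow h)
    · have hiff : (A % 4, B % 4) ∈ ({(0, 1), (2, 3)} : Set (ℤ × ℤ)) ↔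
          A % 4 = 0 ∧ B % 4 = 1 ∨ A % 4 = 2 ∧ B % 4 = 3 := by simp
      by_cases h : A % 4 = 0 ∧ B % 4 = 1 ∨ A % 4 = 2 ∧ B % 4 = 3
      · have := hreg fun M hM hpM => notMem_sq_two_of_even_odd hk h hM hpM
        exact iff_of_true this (.inl ⟨rfl, hiff.2 h⟩)
      · have := hsing (exists_mem_sq_two_of_even_odd hk hA hB h)
        exact iff_of_false (not_not.2 this) (by
          rintro (⟨-, h'⟩ | ⟨h', -⟩)
          exacts [h (hiff.1 h'), absurd h' (by norm_num)])
    · have hiff := mem_residuePairs_iff hk hA hB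
      by_cases h : (A % 9, B % 9) ∈ residuePairs k
      · have := hreg fun M hM hpM =>
          notMem_sq_three hk hA hB (hiff.1 h).1 (hiff.1 h).2 hM hpM
        exact iff_of_true this (.inr ⟨rfl, h⟩)
      · have := hsing (exists_mem_sq_three hk hA (by
          by_contra! hcon
          exact h (hiff.2 ⟨fun _ => hcon.1, fun _ => hcon.2⟩)))
        exact iff_of_false (not_not.2 this) (by
          rintro (⟨h', -⟩ | ⟨-, h'⟩)
          exacts [absurd h' (by norm_num), h h'])
  · have h5 : (p : ℤ) ∣ 2 * A * B := hB.mul_left _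
    have h4 : p = 2 → (2 : ℤ) ∣ A * B := by rintro rfl; exact hB.mul_left _
    have h4' : ¬ (p = 2 ∧ ¬ (2 : ℤ) ∣ A * B) := fun h => h.2 (h4 h.1)
    simp only [hA, hB, h5, h4', not_true_eq_false, not_false_eq_true, true_and, false_and, or_false,
      false_or, Prod.mk.injEq]
    by_cases hB2 : (p : ℤ) ^ 2 ∣ B
    · have := hsing (exists_mem_sq_of_sq_dvd hk hB2)
      have hB2' : ¬ (p = 2 ∧ A % 4 = 3 ∧ B % 4 = 2) := by
        rintro ⟨rfl, -, h⟩
        push_cast at hB2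
        omega
      exact iff_of_false (not_not.2 this) (by
        rintro (⟨-, h'⟩ | h')
        exacts [h' hB2, hB2' h'])
    · by_cases h2 : p = 2
      · subst h2
        push_cast at hA hB hB2
        by_cases h3 : A % 4 = 3
        · have := hreg fun M hM hpM => notMem_sq_two_of_odd_even hk h3 (by omega) hM hpM
          exact iff_of_true this (.inr ⟨rfl, h3, by omega⟩)
        -- Here `A ≡ 1` and `B ≡ 2` modulo 4, so `4 ∣ 1 + A + B`.
        · have := hsing (exists_mem_sq_of_sq_dvd_one_add hk
            ⟨3 + k * A, by push_cast; ring⟩ (by push_cast; omega))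
          exact iff_of_false (not_not.2 this) (by
            rintro (⟨h', -⟩ | ⟨-, h', -⟩)
            exacts [h' rfl, h3 h'])
      · have := hreg fun M hM hpM => notMem_sq_of_not_dvd_of_dvd hk h2 hA hB hB2 hM hpM
        exact iff_of_true this (.inl ⟨h2, hB2⟩)
  · have hAB' : ¬ (p : ℤ) ∣ A * B := fun h => (hpz.dvd_or_dvd h).elim hA hB
    simp only [hA, hB, not_false_eq_true, true_and, false_and, and_false, false_or]
    by_cases h2 : p = 2
    · subst h2
      have := hreg fun M hM hpM => notMem_sq_two_of_odd_odd hk hA hB hM hpM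
      exact iff_of_true this (.inl ⟨rfl, hAB'⟩)
    · have h2' : ¬ (p : ℤ) ∣ 2 := fun h => h2 (hdvd Nat.prime_two h)
      have h5 : ¬ (p : ℤ) ∣ 2 * A * B := by
        rw [mul_assoc]
        exact fun h => (hpz.dvd_or_dvd h).elim h2' hAB'
      have hδp := hδ h2' hB
      by_cases hδ2 : (p : ℤ) ^ 2 ∣ sexticDelta A B k
      -- If `p = 3`, then `p ∣ δ` would give `p ∣ 4A³`.
      · have h3 : ¬ (p : ℤ) ∣ 3 := fun h3 => by
          rw [sexticDelta, show (27 : ℤ) = 3 * 9 by norm_num, mul_assoc,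
            dvd_add_left (h3.mul_right _), show (4 : ℤ) = 2 ^ 2 by norm_num] at hδp
          exact (hpz.dvd_or_dvd hδp).elim (fun h => h2' (hpz.dvd_of_dvd_pow h))
            fun h => hA (hpz.dvd_of_dvd_pow h)
        have := hsing (exists_mem_sq_of_sq_dvd_sexticDelta hp hk h2' h3 hA hδ2)
        exact iff_of_false (not_not.2 this) (by
          rintro (⟨h', -⟩ | ⟨-, h'⟩)
          exacts [h2 h', h' hδ2])
      · have := hreg fun M hM hpM =>
          notMem_sq_of_not_sq_dvd_sexticDelta hk h2' hB hδp hδ2 hM hpM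
        exact iff_of_true this (.inr ⟨h5, hδ2⟩)
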